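/- Let $\mathbb{I}=\{\mathbf i\in\mathbb{Z}_{\ge0}^7: i_0+\cdots+i_6=3\}$ be the set of exponents of cubic monomials in $x_0,\dots,x_6$. A one-parameter subgroup (1-PS) of the diagonal torus $\mathbb{T}\subset \mathrm{SL}(7)$ is a nonzero vector $\mathbf r\in\mathbb{Z}^7_{(0)}=\{\mathbf r\in\mathbb{Z}^7: r_0+\cdots+r_6=0\}$; put $\mathbb{I}(\mathbf r)_{\ge0}=\{\mathbf i\in\mathbb{I}:\mathbf r\cdot\mathbf i\ge0\}$ and $\mathbb{I}(\mathbf r)_{>0}=\{\mathbf i\in\mathbb{I}:\mathbf r\cdot\mathbf i>0\}$. A set $s\subseteq\mathbb{I}$ is not stable (resp. unstable) with respect to $\mathbb{T}$ if $s\subseteq\mathbb{I}(\mathbf r)_{\ge0}$ (resp. $s\subseteq\mathbb{I}(\mathbf r)_{>0}$) for some 1-PS $\mathbf r$, and strictly semi-stable if it is not stable and not unstable. A nonzero cubic form $f\in\mathbb{C}[x_0,\dots,x_6]_3$ is strictly semi-stable with respect to $\mathbb{T}$ if its support $\mathrm{Supp}(f)\subseteq\mathbb{I}$ is. For $J\subseteq\mathbb{I}$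 let $F_J=\{f\in\mathbb{C}[x_0,\dots,x_6]_3:\mathrm{Supp}(f)\subseteq J\}$; a $\mathbb{T}$-strictly-semi-stable family is a set $F_{\mathrm{Supp}(f)}$ with $f$ strictly semi-stable with respect to $\mathbb{T}$. A vector $\mathbf r\in\mathbb{Z}^7$ is reduced if $\frac1\alpha\mathbf r\notin\mathbb{Z}^7$ for every integer $\alpha$ with $|\alpha|\ge2$. The group $S_7$ acts on $\mathbb{Z}^7$ by permuting coordinates. Maximality is with respect to inclusion. Consider the vectors $\mathbf r_1=(8,3,2,-1,-2,-4,-6)$, $\mathbf r_2=(6,4,1,-1,-2,-3,-5)$, $\mathbf r_3=(4,2,1,-1,-1,-2,-3)$, $\mathbf r_4=(2,2,0,-1,-1,-1,-1)$, $\mathbf r_5=(3,2,1,0,-1,-2,-3)$, $\mathbf r_6=(4,2,1,0,-1,-2,-4)$, $\mathbf r_7=(5,3,2,1,-1,-4,-6)$, $\mathbf r_8=(6,4,2,1,-2,-3,-8)$, $\mathbf r_9=(4,1,1,0,-2,-2,-2)$, $\mathbf r_{10}=(2,2,0,0,-1,-1,-2)$, $\mathbf r_{11}=(2,1,0,0,-1,-1,-1)$,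 $\mathbf r_{12}=(3,2,1,1,-1,-2,-4)$, $\mathbf r_{13}=(2,1,1,0,-1,-1,-2)$, $\mathbf r_{14}=(2,2,2,0,-1,-1,-4)$, $\mathbf r_{15}=(2,0,0,0,0,-1,-1)$, $\mathbf r_{16}=(2,1,1,0,0,-2,-2)$, $\mathbf r_{17}=(2,1,0,0,0,-1,-2)$, $\mathbf r_{18}=(1,1,1,0,0,-1,-2)$, $\mathbf r_{19}=(1,1,0,0,0,-1,-1)$, $\mathbf r_{20}=(1,1,1,1,0,-2,-2)$, $\mathbf r_{21}=(1,1,0,0,0,0,-2)$, $\mathbf r_{22}=(1,0,0,0,0,0,-1)$, $\mathbf r_{23}=(8,5,3,2,-4,-4,-10)$. Then: 1. Each $\mathbf r_k$ is a reduced 1-PS with nonincreasing entries. 2. The maximal elements of $\mathcal S=\{\mathbb{I}(\mathbf r)_{\ge0}:\mathbf 0\ne\mathbf r\in\mathbb{Z}^7_{(0)}\}$ are exactly the images of $\mathbb{I}(\mathbf r_1)_{\ge0},\dots,\mathbb{I}(\mathbf r_{23})_{\ge0}$ under permutations of the coordinates, and no two of these 23 sets are related by a permutation. 3. For $1\le k\le23$,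 the set $\mathbb{I}(\mathbf r_k)_{\ge0}$ is unstable with respect to $\mathbb{T}$ if and only if $k=23$. 4. The maximal elements among the subsets of $\mathbb{I}$ that are strictly semi-stable with respect to $\mathbb{T}$ are exactly the images of $\mathbb{I}(\mathbf r_1)_{\ge0},\dots,\mathbb{I}(\mathbf r_{22})_{\ge0}$ under permutations of the coordinates. The maximal $\mathbb{T}$-strictly-semi-stable families are exactly the $F_J$ for these sets $J$, and every cubic form that is strictly semi-stable with respect to $\mathbb{T}$ belongs to one of them. -/

import Mathlib

namespace CubicFivefold

/-- The simplex `𝕀`: exponent vectors of the cubic monomials in `x₀, …, x₆`. -/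
def simplex : Set (Fin 7 → ℤ) :=
  {x | ∑ k, x k = 3 ∧ ∀ k, 0 ≤ x k}

/-- The integral vectors of weight `0`. -/
def weightZero : Set (Fin 7 → ℤ) :=
  {r | ∑ k, r k = 0}

/-- The set `𝕀(r)_{≥ 0}`. -/
def nonnegPart (r : Fin 7 → ℤ) : Set (Fin 7 → ℤ) :=
  {i | i ∈ simplex ∧ 0 ≤ r ⬝ᵥ i}

/-- The set `𝕀(r)_{> 0}`. -/
def posPart (r : Fin 7 → ℤ) : Set (Fin 7 → ℤ) :=
  {i | i ∈ simplex ∧ 0 < r ⬝ᵥ i}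

/-- A vector is reduced if it is not divisible by an integer `α` with `|α| ≥ 2`. -/
def IsReducedVector (r : Fin 7 → ℤ) : Prop :=
  ¬ ∃ α : ℤ, 2 ≤ |α| ∧ ∃ s : Fin 7 → ℤ, r = α • s

/-- The vector `r` is a (nontrivial) one-parameter subgroup `diag(t^{r₀}, …, t^{r₆})` of the
diagonal maximal torus of `SL(7)`. -/
def IsOnePS (r : Fin 7 → ℤ) : Prop :=
  r ∈ weightZero ∧ r ≠ 0

/-- The collection of the sets `𝕀(r)_{≥ 0}`, for all one-parameter subgroups `r`. -/
def halfSimplices : Set (Set (Fin 7 → ℤ)) :=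
  {A | ∃ r, IsOnePS r ∧ A = nonnegPart r}

/-- `s` is not stable with respect to the torus. -/
def NotStable (s : Set (Fin 7 → ℤ)) : Prop :=
  ∃ r, IsOnePS r ∧ s ⊆ nonnegPart r

/-- `s` is unstable with respect to the torus. -/
def Unstable (s : Set (Fin 7 → ℤ)) : Prop :=
  ∃ r, IsOnePS r ∧ s ⊆ posPart r

/-- `s` is strictly semi-stable with respect to the torus: semi-stable (that is, not unstable)
but not stable. -/
def StrictlySemistable (s : Set (Fin 7 → ℤ)) : Prop :=
  NotStable s ∧ ¬ Unstable s

/-- The permutation action of `S₇` on sets of exponent vectors. -/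
def permute (σ : Equiv.Perm (Fin 7)) (A : Set (Fin 7 → ℤ)) : Set (Fin 7 → ℤ) :=
  (fun x => x ∘ σ) '' A

/-- The support of a polynomial, as a set of integral vectors. -/
def supp (f : MvPolynomial (Fin 7) ℂ) : Set (Fin 7 → ℤ) :=
  {x | ∃ m ∈ f.support, ∀ k, x k = (m k : ℤ)}

/-- A nonzero cubic form whose support is strictly semi-stable with respect to the torus. -/
def StrictlySemistableCubic (f : MvPolynomial (Fin 7) ℂ) : Prop :=
  f.IsHomogeneous 3 ∧ f ≠ 0 ∧ StrictlySemistable (supp f)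

/-- The family of all cubic forms whose support is contained in `J`. -/
def cubicFamily (J : Set (Fin 7 → ℤ)) : Set (MvPolynomial (Fin 7) ℂ) :=
  {f | f.IsHomogeneous 3 ∧ supp f ⊆ J}

/-- The family of cubic forms supported in the support of a given form `f` (a generic member)
that is strictly semi-stable with respect to the torus. -/
def StrictlySemistableFamily (V : Set (MvPolynomial (Fin 7) ℂ)) : Prop :=
  ∃ f, StrictlySemistableCubic f ∧ V = cubicFamily (supp f)

/-- The vectors `r₁, …, r₂₃`; the vector `r_k` has index `k - 1`. -/
def rVec : Fin 23 → Fin 7 → ℤ :=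
  ![![8, 3, 2, -1, -2, -4, -6],
    ![6, 4, 1, -1, -2, -3, -5],
    ![4, 2, 1, -1, -1, -2, -3],
    ![2, 2, 0, -1, -1, -1, -1],
    ![3, 2, 1, 0, -1, -2, -3],
    ![4, 2, 1, 0, -1, -2, -4],
    ![5, 3, 2, 1, -1, -4, -6],
    ![6, 4, 2, 1, -2, -3, -8],
    ![4, 1, 1, 0, -2, -2, -2],
    ![2, 2, 0, 0, -1, -1, -2],
    ![2, 1, 0, 0, -1, -1, -1],
    ![3, 2, 1, 1, -1, -2, -4],
    ![2, 1, 1, 0, -1, -1, -2],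
    ![2, 2, 2, 0, -1, -1, -4],
    ![2, 0, 0, 0, 0, -1, -1],
    ![2, 1, 1, 0, 0, -2, -2],
    ![2, 1, 0, 0, 0, -1, -2],
    ![1, 1, 1, 0, 0, -1, -2],
    ![1, 1, 0, 0, 0, -1, -1],
    ![1, 1, 1, 1, 0, -2, -2],
    ![1, 1, 0, 0, 0, 0, -2],
    ![1, 0, 0, 0, 0, 0, -1],
    ![8, 5, 3, 2, -4, -4, -10]]

/-- The index of the vector `r₂₃`. -/
def lastIndex : Fin 23 := Fin.last 22

end CubicFivefold

open CubicFivefold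

/-!
A set that is not stable lies in some `𝕀(r)_{≥ 0}`, so everything follows from two facts about these
half-simplices: each of them lies in a permutation of one of the 23 listed ones, and the listed ones
form an antichain up to permutations. All monomials `x_a x_b x_c` are handled as triples `(a, b, c)`
with the componentwise (dominance) order, along which nonincreasing weight vectors decrease.

*Covering* (`exists_nonnegPart_subset_permute`). After a permutation `r` is nonincreasing. If
`𝕀(r)_{≥ 0}` lay in none of the listed sets, then `r` would be nonnegative, for each `k`, on one of
the few dominance-maximal monomials outside `𝕀(r_k)_{≥ 0}`, the `frontier` of `k`. A finite search
(`refutes_searchOrder`) runs through the choices of one monomial from each frontier. Every branch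
ends in a set of monomials with a weighted sum strictly below the barycentre `(3/7, …, 3/7)` in
dominance order, and summation by parts shows that a nontrivial nonincreasing `r` is negative on
such a sum (`Combination.BelowBarycentre.dotProduct_neg`).

*Antichain* (`permute_rVec_antichain`). For nonincreasing `r` and `s`, an inclusion of `𝕀(r)_{≥ 0}`
in a permutation of `𝕀(s)_{≥ 0}` implies `𝕀(r)_{≥ 0} ⊆ 𝕀(s)_{≥ 0}`, because inversions of a
rearrangement of `s` can be removed by swaps (`nonnegPart_subset_of_subset_permute`). Among the
listed sets such an inclusion holds only between equal ones: for `k ≠ l` some monomial of the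
frontier of `l` has nonnegative weight for `r_k`.

The last listed set is unstable because a nearby weight vector is positive on it. Each of the others
contains seven monomials with product `(x₀ ⋯ x₆)³`, on which no weight vector of total weight `0`
can be positive simultaneously. Finally, inclusions between families of cubic forms are inclusions
between their sets of exponents, as every set of exponents is the support of a form.
-/

namespace CubicFivefold

/-! ### Cubic monomials as triples of indices -/

/-- The monomial `x_a x_b x_c`, written as the triple `(a, b, c)`. Each cubic monomial is
represented by exactly one triple with `a ≤ b ≤ c`; the componentwise order of triples is the
dominance order, in which smaller triples have larger weight for nonincreasing weight vectors. -/
abbrev Triple : Type := Fin 7 × Fin 7 × Fin 7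

namespace Triple

/-- The exponent vector of the monomial `x_a x_b x_c`. -/
def exponent (t : Triple) : Fin 7 → ℤ :=
  Pi.single t.1 1 + Pi.single t.2.1 1 + Pi.single t.2.2 1

/-- The weight `r_a + r_b + r_c` of the monomial `x_a x_b x_c` with respect to `r`. -/
def weight (r : Fin 7 → ℤ) (t : Triple) : ℤ :=
  r t.1 + r t.2.1 + r t.2.2

/-- The triple is nondecreasing. -/
abbrev Sorted (t : Triple) : Prop := t.1 ≤ t.2.1 ∧ t.2.1 ≤ t.2.2

theorem dotProduct_exponent (r : Fin 7 → ℤ) (t : Triple) : r ⬝ᵥ t.exponent = t.weight r := by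
  simp [exponent, weight, dotProduct_add]

theorem weight_anti {r : Fin 7 → ℤ} (hr : Antitone r) {s t : Triple} (h : s ≤ t) :
    t.weight r ≤ s.weight r :=
  add_le_add (add_le_add (hr h.1) (hr h.2.1)) (hr h.2.2)

theorem exponent_mem_simplex (t : Triple) : t.exponent ∈ simplex := by
  refine ⟨?_, fun k => ?_⟩
  · simp [exponent, Finset.sum_add_distrib]
  · have h : ∀ i : Fin 7, 0 ≤ (Pi.single i 1 : Fin 7 → ℤ) k := fun i => by
      rw [Pi.single_apply]; split <;> simp
    exact add_nonneg (add_nonneg (h _) (h _)) (h _)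

end Triple

/-- Split off one variable from a monomial of positive degree. -/
theorem exists_eq_add_single {x : Fin 7 → ℤ} {d : ℤ} (hd : 0 ≤ d) (hx : ∀ k, 0 ≤ x k)
    (hs : ∑ k, x k = d + 1) :
    ∃ (a : Fin 7) (y : Fin 7 → ℤ), x = y + Pi.single a 1 ∧ (∀ k, 0 ≤ y k) ∧ ∑ k, y k = d := by
  obtain ⟨a, -, ha⟩ : ∃ a ∈ Finset.univ, (0 : ℤ) < x a :=
    Finset.exists_lt_of_sum_lt (by simp only [Finset.sum_const_zero]; omega)
  refine ⟨a, x - Pi.single a 1, by simp, fun k => ?_, ?_⟩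
  · rcases eq_or_ne k a with rfl | h
    · simp only [Pi.sub_apply, Pi.single_eq_same]; omega
    · rw [Pi.sub_apply, Pi.single_eq_of_ne h, sub_zero]
      exact hx k
  · simp [Finset.sum_sub_distrib, hs]

theorem exists_sorted_of_mem_simplex {x : Fin 7 → ℤ} (hx : x ∈ simplex) :
    ∃ t : Triple, t.Sorted ∧ x = t.exponent := by
  obtain ⟨a, y, rfl, hy, hsy⟩ := exists_eq_add_single (d := 2) (by norm_num) hx.2 hx.1
  obtain ⟨b, z, rfl, hz, hsz⟩ := exists_eq_add_single (d := 1) (by norm_num) hy hsy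
  obtain ⟨c, w, rfl, hw, hsw⟩ := exists_eq_add_single (d := 0) (by norm_num) hz hsz
  have hw0 : w = 0 := by
    funext k
    exact (Finset.sum_eq_zero_iff_of_nonneg fun i _ => hw i).1 hsw k (Finset.mem_univ k)
  subst hw0
  rcases le_total a b with h₁ | h₁ <;> rcases le_total b c with h₂ | h₂ <;>
    rcases le_total a c with h₃ | h₃
  · exact ⟨(a, b, c), ⟨h₁, h₂⟩, by simp only [Triple.exponent]; abel⟩
  · exact ⟨(a, b, c), ⟨h₁, h₂⟩, by simp only [Triple.exponent]; abel⟩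
  · exact ⟨(a, c, b), ⟨h₃, h₂⟩, by simp only [Triple.exponent]; abel⟩
  · exact ⟨(c, a, b), ⟨h₃, h₁⟩, by simp only [Triple.exponent]; abel⟩
  · exact ⟨(b, a, c), ⟨h₁, h₃⟩, by simp only [Triple.exponent]; abel⟩
  · exact ⟨(b, c, a), ⟨h₂, h₃⟩, by simp only [Triple.exponent]; abel⟩
  · exact ⟨(c, b, a), ⟨h₂, h₁⟩, by simp only [Triple.exponent]; abel⟩
  · exact ⟨(c, b, a), ⟨h₂, h₁⟩, by simp only [Triple.exponent]; abel⟩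

theorem exponent_mem_nonnegPart {r : Fin 7 → ℤ} {t : Triple} :
    t.exponent ∈ nonnegPart r ↔ 0 ≤ t.weight r := by
  simp [nonnegPart, t.exponent_mem_simplex, Triple.dotProduct_exponent]

theorem finite_simplex : simplex.Finite :=
  (Set.finite_range Triple.exponent).subset fun _ hx =>
    let ⟨t, _, ht⟩ := exists_sorted_of_mem_simplex hx
    ⟨t, ht.symm⟩

/-! ### Permutations of the coordinates -/

theorem permute_permute (σ τ : Equiv.Perm (Fin 7)) (A : Set (Fin 7 → ℤ)) :
    permute τ (permute σ A) = permute (σ * τ) A := by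
  simp only [permute, Set.image_image]; rfl

theorem permute_one (A : Set (Fin 7 → ℤ)) : permute 1 A = A := by
  simp [permute]

theorem permute_mono (σ : Equiv.Perm (Fin 7)) {A B : Set (Fin 7 → ℤ)} (h : A ⊆ B) :
    permute σ A ⊆ permute σ B :=
  Set.image_mono h

theorem subset_permute_iff {σ : Equiv.Perm (Fin 7)} {A B : Set (Fin 7 → ℤ)} :
    A ⊆ permute σ B ↔ permute σ⁻¹ A ⊆ B := by
  constructor <;> intro h
  · simpa [permute_permute, permute_one] using permute_mono σ⁻¹ h
  · simpa [permute_permute, permute_one] using permute_mono σ h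

theorem dotProduct_comp_perm (r x : Fin 7 → ℤ) (σ : Equiv.Perm (Fin 7)) :
    (r ∘ σ) ⬝ᵥ (x ∘ σ) = r ⬝ᵥ x :=
  Equiv.sum_comp σ fun k => r k * x k

theorem comp_perm_mem_simplex {x : Fin 7 → ℤ} (hx : x ∈ simplex) (σ : Equiv.Perm (Fin 7)) :
    x ∘ σ ∈ simplex :=
  ⟨(Equiv.sum_comp σ x).trans hx.1, fun k => hx.2 (σ k)⟩

theorem permute_inter_simplex (P : ℤ → Prop) (r : Fin 7 → ℤ) (σ : Equiv.Perm (Fin 7)) :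
    permute σ {x | x ∈ simplex ∧ P (r ⬝ᵥ x)} = {x | x ∈ simplex ∧ P ((r ∘ σ) ⬝ᵥ x)} := by
  ext x
  constructor
  · rintro ⟨y, ⟨hy, hr⟩, rfl⟩
    exact ⟨comp_perm_mem_simplex hy σ, by simpa only [dotProduct_comp_perm] using hr⟩
  · rintro ⟨hx, hr⟩
    have h : (x ∘ σ.symm) ∘ σ = x := by funext k; simp
    refine ⟨x ∘ σ.symm, ⟨comp_perm_mem_simplex hx σ.symm, ?_⟩, h⟩
    rwa [← dotProduct_comp_perm r _ σ, h]

theorem permute_nonnegPart (r : Fin 7 → ℤ) (σ : Equiv.Perm (Fin 7)) :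
    permute σ (nonnegPart r) = nonnegPart (r ∘ σ) :=
  permute_inter_simplex (fun z => 0 ≤ z) r σ

theorem permute_posPart (r : Fin 7 → ℤ) (σ : Equiv.Perm (Fin 7)) :
    permute σ (posPart r) = posPart (r ∘ σ) :=
  permute_inter_simplex (fun z => 0 < z) r σ

theorem IsOnePS.comp_perm {r : Fin 7 → ℤ} (hr : IsOnePS r) (σ : Equiv.Perm (Fin 7)) :
    IsOnePS (r ∘ σ) := by
  refine ⟨(Equiv.sum_comp σ r).trans hr.1, fun h => hr.2 ?_⟩
  funext k
  simpa using congrFun h (σ.symm k)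

theorem Unstable.permute {A : Set (Fin 7 → ℤ)} (h : Unstable A) (σ : Equiv.Perm (Fin 7)) :
    Unstable (permute σ A) := by
  obtain ⟨r, hr, hA⟩ := h
  exact ⟨r ∘ σ, hr.comp_perm σ, permute_posPart r σ ▸ permute_mono σ hA⟩

theorem unstable_permute_iff {A : Set (Fin 7 → ℤ)} {σ : Equiv.Perm (Fin 7)} :
    Unstable (CubicFivefold.permute σ A) ↔ Unstable A := by
  refine ⟨fun h => ?_, fun h => h.permute σ⟩
  simpa [permute_permute, permute_one] using h.permute σ⁻¹

theorem Unstable.mono {A B : Set (Fin 7 → ℤ)} (hB : Unstable B) (h : A ⊆ B) : Unstable A :=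
  let ⟨r, hr, hA⟩ := hB
  ⟨r, hr, h.trans hA⟩

/-! ### Sorting the coordinates of a weight vector -/

/-- Interchanging two entries of `u` changes a scalar product by a single product. -/
theorem dotProduct_comp_swap (u x : Fin 7 → ℤ) {i j : Fin 7} (hij : i ≠ j) :
    (u ∘ Equiv.swap i j) ⬝ᵥ x = u ⬝ᵥ x + (u j - u i) * (x i - x j) := by
  have h : ∑ k, (u (Equiv.swap i j k) - u k) * x k =
      (u (Equiv.swap i j i) - u i) * x i + (u (Equiv.swap i j j) - u j) * x j :=
    Fintype.sum_eq_add i j hij fun k hk => by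
      rw [Equiv.swap_apply_of_ne_of_ne hk.1 hk.2, sub_self, zero_mul]
  rw [Equiv.swap_apply_left, Equiv.swap_apply_right] at h
  have h' : ∑ k, (u (Equiv.swap i j k) - u k) * x k = (u ∘ Equiv.swap i j) ⬝ᵥ x - u ⬝ᵥ x := by
    simp only [sub_mul, Finset.sum_sub_distrib, dotProduct, Function.comp_apply]
  linarith

theorem nonnegPart_subset_comp_swap {r u : Fin 7 → ℤ} (hr : Antitone r) {i j : Fin 7}
    (hij : i < j) (hu : u i < u j) (h : nonnegPart r ⊆ nonnegPart u) :
    nonnegPart r ⊆ nonnegPart (u ∘ Equiv.swap i j) := by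
  rintro x ⟨hx, hrx⟩
  refine ⟨hx, ?_⟩
  rcases le_total (x j) (x i) with hji | hji
  · rw [dotProduct_comp_swap u x hij.ne]
    have := (h ⟨hx, hrx⟩).2
    have := mul_nonneg (sub_nonneg.2 hu.le) (sub_nonneg.2 hji)
    linarith
  · -- The monomial with `x i` and `x j` interchanged dominates `x`, so lies in `𝕀(r)_{≥ 0}` too.
    have hsw : ∀ v : Fin 7 → ℤ, v ⬝ᵥ (x ∘ Equiv.swap i j) = (v ∘ Equiv.swap i j) ⬝ᵥ x := by
      intro v
      rw [← dotProduct_comp_perm _ x (Equiv.swap i j)]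
      congr 1
      funext k
      simp
    have h' : x ∘ Equiv.swap i j ∈ nonnegPart r := by
      refine ⟨comp_perm_mem_simplex hx _, ?_⟩
      rw [hsw, dotProduct_comp_swap r x hij.ne]
      have := mul_nonneg (sub_nonneg.2 (hr hij.le)) (sub_nonneg.2 hji)
      linarith
    rw [← hsw]
    exact (h h').2

/-- Among the rearrangements `u` of `s` with `𝕀(r)_{≥ 0} ⊆ 𝕀(u)_{≥ 0}`, the one that gives the
largest `∑ k, -k * u k` is nonincreasing, because an inversion could be removed by a swap. -/
theorem nonnegPart_subset_of_subset_permute {r s : Fin 7 → ℤ} (hr : Antitone r) (hs : Antitone s)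
    {σ : Equiv.Perm (Fin 7)} (h : nonnegPart r ⊆ permute σ (nonnegPart s)) :
    nonnegPart r ⊆ nonnegPart s := by
  rw [permute_nonnegPart] at h
  let w : Fin 7 → ℤ := fun k => -(k : ℕ)
  obtain ⟨τ, hτ, hmax⟩ := Set.exists_max_image
    {τ : Equiv.Perm (Fin 7) | nonnegPart r ⊆ nonnegPart (s ∘ τ)} (fun τ => (s ∘ τ) ⬝ᵥ w)
    (Set.toFinite _) ⟨σ, h⟩
  have hanti : Antitone (s ∘ τ) := by
    intro i j hij
    by_contra! hlt
    have hij' : i < j := lt_of_le_of_ne hij fun e => by subst e; exact lt_irrefl _ hlt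
    have hcomp : s ∘ ⇑(τ * Equiv.swap i j) = (s ∘ τ) ∘ Equiv.swap i j := rfl
    have hle := hmax (τ * Equiv.swap i j) (by
      rw [Set.mem_ofPred_eq, hcomp]
      exact nonnegPart_subset_comp_swap hr hij' hlt hτ)
    simp only [hcomp] at hle
    have heq := dotProduct_comp_swap (s ∘ τ) w hij'.ne
    have hw : 0 < w i - w j := by
      have : (i : ℕ) < j := hij'
      simp only [w]
      omega
    have hpos := mul_pos (sub_pos.2 hlt) hw
    linarith
  have : s ∘ τ = s := by
    have := Tuple.unique_monotone (f := OrderDual.toDual ∘ s) (σ := τ) (τ := 1)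
      hanti.dual_right hs.dual_right
    exact this
  rwa [Set.mem_ofPred_eq, this] at hτ

theorem exists_antitone_comp_perm (r : Fin 7 → ℤ) : ∃ σ : Equiv.Perm (Fin 7), Antitone (r ∘ σ) :=
  ⟨Tuple.sort (OrderDual.toDual ∘ r), (Tuple.monotone_sort (OrderDual.toDual ∘ r)).dual_right⟩

/-! ### Certificates: nonnegative combinations of monomials -/

/-- A formal combination of monomials with natural numbers as coefficients. -/
abbrev Combination : Type := List (ℕ × Triple)

namespace Combination

/-- The vector `∑ w • exponent t` over the terms `(w, t)` of the combination. -/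
def total (c : Combination) : Fin 7 → ℤ :=
  (c.map fun p => (p.1 : ℤ) • p.2.exponent).sum

theorem dotProduct_total (r : Fin 7 → ℤ) (c : Combination) :
    r ⬝ᵥ c.total = (c.map fun p => (p.1 : ℤ) * p.2.weight r).sum := by
  induction c with
  | nil => simp [total]
  | cons p c ih =>
    have h : total (p :: c) = (p.1 : ℤ) • p.2.exponent + total c := by simp [total]
    rw [h, dotProduct_add, ih, dotProduct_smul, Triple.dotProduct_exponent]
    simp

theorem dotProduct_total_nonneg {r : Fin 7 → ℤ} {c : Combination}
    (h : ∀ p ∈ c, 0 ≤ p.2.weight r) : 0 ≤ r ⬝ᵥ c.total := by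
  rw [dotProduct_total]
  refine List.sum_nonneg fun x hx => ?_
  obtain ⟨p, hp, rfl⟩ := List.mem_map.1 hx
  exact mul_nonneg (Int.natCast_nonneg _) (h p hp)

theorem dotProduct_total_pos {r : Fin 7 → ℤ} {c : Combination} (hc : c ≠ [])
    (hw : ∀ p ∈ c, 0 < p.1) (h : ∀ p ∈ c, 0 < p.2.weight r) : 0 < r ⬝ᵥ c.total := by
  rw [dotProduct_total]
  refine List.sum_pos _ (fun x hx => ?_) (by simpa using hc)
  obtain ⟨p, hp, rfl⟩ := List.mem_map.1 hx
  exact mul_pos (Int.natCast_pos.2 (hw p hp)) (h p hp)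

/-- The combination lies strictly below the barycentre of the simplex in the dominance order: each
proper initial sum of its total is less than the corresponding fraction of the full sum. -/
def BelowBarycentre (c : Combination) : Prop :=
  ∀ j : Fin 6,
    7 * ∑ i ∈ Finset.univ.filter (fun i : Fin 7 => (i : ℕ) ≤ j), c.total i <
      ((j : ℕ) + 1) * ∑ i, c.total i

instance (c : Combination) : Decidable c.BelowBarycentre :=
  inferInstanceAs (Decidable (∀ _ : Fin 6, _))

/-- A nontrivial nonincreasing weight vector is negative on every combination strictly below the
barycentre. -/
theorem BelowBarycentre.dotProduct_neg {c : Combination} (hc : c.BelowBarycentre)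
    {r : Fin 7 → ℤ} (hr : IsOnePS r) (hanti : Antitone r) : r ⬝ᵥ c.total < 0 := by
  by_contra! hnn
  have hsum : ∑ k, r k = 0 := hr.1
  have h0 := hc 0
  have h1 := hc 1
  have h2 := hc 2
  have h3 := hc 3
  have h4 := hc 4
  have h5 := hc 5
  simp [Finset.sum_filter, Fin.sum_univ_seven] at h0 h1 h2 h3 h4 h5
  simp only [dotProduct, Fin.sum_univ_seven] at hnn hsum
  generalize c.total = t at *
  have d0 : 0 ≤ r 0 - r 1 := sub_nonneg.2 (hanti (by decide))
  have d1 : 0 ≤ r 1 - r 2 := sub_nonneg.2 (hanti (by decide))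
  have d2 : 0 ≤ r 2 - r 3 := sub_nonneg.2 (hanti (by decide))
  have d3 : 0 ≤ r 3 - r 4 := sub_nonneg.2 (hanti (by decide))
  have d4 : 0 ≤ r 4 - r 5 := sub_nonneg.2 (hanti (by decide))
  have d5 : 0 ≤ r 5 - r 6 := sub_nonneg.2 (hanti (by decide))
  -- Summation by parts: `7 * (r ⬝ᵥ t)` is minus the sum of the six products of the (nonnegative)
  -- differences of `r` with the (positive) gaps of `hc`, so all the differences vanish.
  have hT := congrArg (· * (t 0 + t 1 + t 2 + t 3 + t 4 + t 5 + t 6)) hsum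
  simp only [zero_mul] at hT
  have gap : ∀ {d a b : ℤ}, 0 ≤ d → a < b → d ≤ d * (b - a) := fun hd hab => by nlinarith
  have g0 := gap d0 h0
  have g1 := gap d1 h1
  have g2 := gap d2 h2
  have g3 := gap d3 h3
  have g4 := gap d4 h4
  have g5 := gap d5 h5
  have hle : r 0 - r 6 ≤ 0 := by linarith only [g0, g1, g2, g3, g4, g5, hT, hnn]
  refine hr.2 (funext fun k => ?_)
  fin_cases k <;> simp <;> linarith

end Combination
/-! ### The covering of the nonincreasing weight vectors -/

/-- The dominance-maximal monomials of negative weight with respect to `rVec k`. -/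
def frontier : Fin 23 → List Triple :=
  ![[(0, 5, 6), (1, 2, 6), (1, 3, 5), (1, 4, 4), (2, 3, 4), (3, 3, 3)],
    [(0, 4, 6), (1, 3, 6), (1, 4, 5), (2, 2, 5), (2, 3, 3)],
    [(0, 5, 6), (1, 3, 5), (2, 2, 6), (2, 3, 3)],
    [(2, 2, 3)],
    [(0, 4, 6), (0, 5, 5), (1, 3, 6), (1, 4, 5), (2, 2, 6), (2, 3, 5), (2, 4, 4), (3, 3, 4)],
    [(0, 4, 6), (1, 2, 6), (1, 4, 5), (2, 3, 5), (2, 4, 4), (3, 3, 4)],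
    [(0, 4, 6), (0, 5, 5), (1, 2, 6), (1, 4, 5), (2, 3, 5), (3, 4, 4)],
    [(0, 3, 6), (1, 2, 6), (1, 4, 5), (2, 4, 4), (3, 3, 5)],
    [(1, 3, 4)],
    [(0, 4, 6), (2, 2, 4)],
    [(1, 4, 4), (2, 2, 4)],
    [(0, 4, 6), (0, 5, 5), (1, 2, 6), (1, 4, 5), (2, 4, 4)],
    [(0, 4, 6), (1, 3, 6), (1, 4, 4), (3, 3, 4)],
    [(0, 3, 6), (3, 3, 4)],
    [(1, 1, 5)],
    [(0, 5, 5), (1, 3, 5)],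
    [(0, 5, 6), (1, 2, 6), (1, 5, 5), (2, 2, 5)],
    [(0, 3, 6), (0, 5, 5), (3, 3, 5)],
    [(0, 5, 5), (2, 2, 5)],
    [(0, 4, 5)],
    [(0, 2, 6)],
    [(0, 6, 6), (1, 1, 6)],
    [(0, 4, 6), (1, 2, 6), (1, 4, 4)]]

/-- Combinations of monomials strictly below the barycentre. No nontrivial nonincreasing weight
vector is nonnegative on all the monomials of one of them. -/
def conflicts : List Combination :=
  [[(7, 0, 4, 6), (1, 1, 1, 6), (6, 1, 3, 5), (4, 2, 2, 5)],
   [(20, 0, 3, 6), (7, 0, 5, 5), (8, 1, 1, 6), (12, 1, 4, 4), (14, 2, 2, 5), (4, 3, 3, 4)],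
   [(3, 0, 5, 5), (4, 1, 2, 6), (2, 3, 3, 4)],
   [(8, 0, 5, 6), (1, 1, 1, 6), (6, 1, 3, 4), (4, 2, 2, 4)],
   [(7, 0, 3, 6), (1, 1, 1, 6), (6, 1, 4, 5), (4, 2, 2, 5)],
   [(8, 0, 5, 6), (1, 1, 1, 6), (6, 1, 4, 4), (4, 2, 2, 3)],
   [(7, 0, 4, 6), (5, 0, 5, 5), (6, 1, 1, 6), (2, 2, 2, 5), (9, 2, 3, 4)],
   [(3, 0, 4, 6), (3, 0, 5, 5), (5, 1, 3, 4), (4, 2, 2, 6)],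
   [(2, 0, 5, 5), (3, 1, 3, 6), (1, 2, 2, 4)],
   [(10, 0, 3, 6), (3, 0, 5, 5), (4, 1, 2, 6), (3, 1, 3, 5), (7, 1, 4, 4), (5, 2, 2, 5)],
   [(7, 0, 3, 6), (5, 0, 5, 5), (6, 1, 1, 6), (2, 2, 2, 5), (9, 2, 4, 4)],
   [(2, 0, 3, 6), (7, 0, 4, 5), (8, 1, 2, 6), (2, 1, 3, 5), (1, 2, 2, 5), (3, 3, 3, 4)],
   [(7, 0, 4, 6), (7, 0, 5, 5), (8, 1, 2, 6), (6, 1, 3, 4), (1, 2, 2, 4), (4, 2, 3, 3)],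
   [(9, 0, 3, 6), (10, 0, 5, 5), (11, 1, 2, 6), (9, 1, 4, 4), (2, 2, 2, 4), (5, 2, 3, 3)],
   [(19, 0, 4, 6), (11, 0, 5, 5), (12, 1, 1, 6), (6, 1, 4, 4), (8, 2, 2, 5), (15, 2, 3, 3)],
   [(3, 0, 3, 6), (3, 0, 5, 5), (5, 1, 4, 4), (4, 2, 2, 6)],
   [(11, 0, 3, 6), (3, 0, 5, 5), (4, 1, 1, 6), (7, 1, 4, 4), (9, 2, 3, 5)],
   [(5, 0, 3, 6), (4, 0, 4, 5), (5, 1, 2, 6), (4, 1, 3, 5), (1, 2, 2, 5), (3, 2, 4, 4)],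
   [(9, 0, 4, 6), (2, 0, 5, 5), (3, 1, 2, 6), (7, 1, 3, 5), (1, 1, 4, 4), (4, 2, 2, 3)],
   [(6, 0, 4, 6), (1, 0, 5, 5), (2, 1, 2, 6), (6, 1, 3, 5), (3, 2, 2, 4)],
   [(7, 0, 3, 6), (1, 1, 1, 6), (6, 1, 5, 5), (4, 2, 2, 4)],
   [(6, 0, 4, 6), (2, 0, 5, 5), (3, 1, 1, 6), (2, 1, 3, 4), (4, 2, 2, 5), (2, 3, 3, 3)],
   [(2, 0, 4, 5), (3, 1, 3, 6), (1, 2, 2, 5)],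
   [(5, 0, 3, 6), (4, 0, 4, 5), (5, 1, 1, 6), (6, 2, 3, 5), (3, 2, 4, 4)],
   [(9, 0, 3, 6), (6, 0, 4, 5), (7, 1, 1, 6), (2, 1, 3, 5), (8, 2, 2, 5), (5, 3, 4, 4)],
   [(11, 0, 2, 6), (3, 0, 5, 5), (4, 1, 1, 6), (7, 1, 4, 4), (9, 3, 3, 5)],
   [(8, 0, 6, 6), (1, 1, 1, 5), (6, 1, 4, 4), (4, 2, 2, 3)],
   [(8, 0, 6, 6), (1, 1, 1, 5), (6, 1, 3, 4), (4, 2, 2, 4)],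
   [(3, 0, 4, 6), (3, 0, 5, 5), (4, 1, 2, 6), (2, 1, 4, 4), (3, 2, 3, 3)],
   [(6, 0, 3, 6), (1, 0, 5, 5), (2, 1, 2, 6), (6, 1, 4, 5), (3, 2, 2, 4)],
   [(7, 0, 4, 6), (1, 1, 1, 6), (6, 1, 5, 5), (4, 2, 2, 3)],
   [(3, 0, 3, 6), (3, 0, 4, 5), (3, 1, 3, 5), (2, 1, 4, 4), (4, 2, 2, 6)],
   [(3, 0, 3, 6), (3, 0, 4, 5), (4, 1, 2, 6), (2, 1, 4, 4), (3, 2, 3, 5)],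
   [(5, 0, 2, 6), (1, 1, 1, 6), (4, 1, 5, 5), (3, 3, 3, 4)],
   [(12, 0, 2, 6), (3, 0, 5, 5), (4, 1, 1, 6), (8, 1, 4, 5), (2, 2, 2, 5), (8, 3, 3, 4)],
   [(8, 0, 2, 6), (7, 0, 5, 5), (8, 1, 1, 6), (2, 2, 2, 5), (4, 2, 4, 4), (8, 3, 3, 4)],
   [(3, 0, 4, 5), (4, 1, 2, 6), (2, 3, 3, 5)],
   [(5, 0, 2, 6), (1, 1, 1, 6), (4, 1, 4, 5), (3, 3, 3, 5)],
   [(5, 0, 2, 6), (4, 0, 4, 5), (5, 1, 1, 6), (3, 2, 4, 4), (6, 3, 3, 5)]]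

theorem exists_frontier_le (k : Fin 23) (t : Triple) (ht : t.Sorted)
    (hk : t.weight (rVec k) < 0) : ∃ s ∈ frontier k, s ≤ t := by
  have h : ∀ k, ∀ a b c : Fin 7, a ≤ b → b ≤ c → rVec k a + rVec k b + rVec k c < 0 →
      ∃ s ∈ frontier k, s ≤ (a, b, c) := by decide +kernel
  exact h k t.1 t.2.1 t.2.2 ht.1 ht.2 hk

theorem weight_frontier_neg : ∀ k, ∀ t ∈ frontier k, t.weight (rVec k) < 0 := by
  decide +kernel

theorem belowBarycentre_of_mem_conflicts : ∀ c ∈ conflicts, Combination.BelowBarycentre c := by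
  decide +kernel

/-- Every monomial of some conflict dominates one of the monomials in `P`. -/
def hasConflict (P : List Triple) : Bool :=
  conflicts.any fun c => c.all fun p => P.any fun s => p.2 ≤ s

/-- Search for a set of monomials that contains `P` and, for each `k` in the list, a monomial of
`frontier k`, and that has no conflict. The value is `true` if there is none. An index `k` whose
frontier is met by a consequence of `P` is skipped. -/
def refutes : List (Fin 23) → List Triple → Bool
  | [], P => hasConflict P
  | k :: ks, P => hasConflict P ||
      if P.any fun s => (frontier k).any fun t => t ≤ s then refutes ks P
      else (frontier k).all fun t => refutes ks (t :: P)

/-- An order of the indices that keeps the search small: first the vectors with a single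
monomial in the frontier. -/
def searchOrder : List (Fin 23) :=
  [8, 14, 20, 3, 19, 21, 13, 17, 18, 15, 16, 11, 9, 12, 5, 6, 4, 2, 10, 22, 7, 1, 0]

theorem refutes_searchOrder : refutes searchOrder [] = true := by
  decide +kernel

theorem not_hasConflict {r : Fin 7 → ℤ} (hr : IsOnePS r) (hanti : Antitone r) {P : List Triple}
    (hP : ∀ s ∈ P, 0 ≤ s.weight r) : ¬ hasConflict P = true := by
  intro h
  obtain ⟨c, hc, hcP⟩ := List.any_eq_true.1 h
  refine ((belowBarycentre_of_mem_conflicts c hc).dotProduct_neg hr hanti).not_ge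
    (Combination.dotProduct_total_nonneg fun p hp => ?_)
  obtain ⟨s, hs, hle⟩ := List.any_eq_true.1 (List.all_eq_true.1 hcP p hp)
  exact (hP s hs).trans (Triple.weight_anti hanti (of_decide_eq_true hle))

theorem not_refutes {r : Fin 7 → ℤ} (hr : IsOnePS r) (hanti : Antitone r)
    (hF : ∀ k, ∃ t ∈ frontier k, 0 ≤ t.weight r) (ks : List (Fin 23)) {P : List Triple}
    (hP : ∀ s ∈ P, 0 ≤ s.weight r) : ¬ refutes ks P = true := by
  induction ks generalizing P with
  | nil => exact not_hasConflict hr hanti hP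
  | cons k ks ih =>
    intro h
    rw [refutes, Bool.or_eq_true] at h
    rcases h with h | h
    · exact not_hasConflict hr hanti hP h
    · split at h
      · exact ih hP h
      · obtain ⟨t, ht, hw⟩ := hF k
        exact ih (List.forall_mem_cons.2 ⟨hw, hP⟩) (List.all_eq_true.1 h t ht)

theorem exists_nonnegPart_subset_of_antitone {r : Fin 7 → ℤ} (hr : IsOnePS r)
    (hanti : Antitone r) : ∃ k, nonnegPart r ⊆ nonnegPart (rVec k) := by
  by_contra! hno
  refine not_refutes hr hanti (fun k => ?_) searchOrder (P := []) (by simp) refutes_searchOrder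
  obtain ⟨x, hx, hxk⟩ := Set.not_subset.1 (hno k)
  obtain ⟨t, ht, rfl⟩ := exists_sorted_of_mem_simplex hx.1
  rw [exponent_mem_nonnegPart] at hx hxk
  obtain ⟨s, hs, hst⟩ := exists_frontier_le k t ht (not_le.1 hxk)
  exact ⟨s, hs, hx.trans (Triple.weight_anti hanti hst)⟩

theorem exists_nonnegPart_subset_permute {r : Fin 7 → ℤ} (hr : IsOnePS r) :
    ∃ k σ, nonnegPart r ⊆ permute σ (nonnegPart (rVec k)) := by
  obtain ⟨σ, hσ⟩ := exists_antitone_comp_perm r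
  obtain ⟨k, hk⟩ := exists_nonnegPart_subset_of_antitone (hr.comp_perm σ) hσ
  refine ⟨k, σ⁻¹, subset_permute_iff.2 ?_⟩
  rwa [inv_inv, permute_nonnegPart]

/-! ### The individual vectors -/

theorem antitone_rVec : ∀ k, Antitone (rVec k) := by
  have h : ∀ k, ∀ i j : Fin 7, i ≤ j → rVec k j ≤ rVec k i := by decide +kernel
  exact fun k i j => h k i j

theorem isOnePS_rVec (k : Fin 23) : IsOnePS (rVec k) := by
  have h : ∀ k, ∑ i, rVec k i = 0 ∧ rVec k 0 ≠ 0 := by decide +kernel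
  exact ⟨(h k).1, fun h0 => (h k).2 (congrFun h0 0)⟩

theorem isReducedVector_rVec (k : Fin 23) : IsReducedVector (rVec k) := by
  have h : ∀ k, ∃ i j, rVec k i - rVec k j = 1 := by decide +kernel
  rintro ⟨α, hα, s, hs⟩
  obtain ⟨i, j, hij⟩ := h k
  have hdvd : α ∣ 1 := ⟨s i - s j, by rw [← hij, hs, mul_sub]; rfl⟩
  have := Int.le_of_dvd one_pos ((abs_dvd α 1).2 hdvd)
  omega

theorem eq_of_nonnegPart_subset {k l : Fin 23}
    (hkl : nonnegPart (rVec k) ⊆ nonnegPart (rVec l)) : k = l := by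
  have h : ∀ k l, k ≠ l → ∃ t ∈ frontier l, 0 ≤ t.weight (rVec k) := by decide +kernel
  by_contra hne
  obtain ⟨t, ht, hw⟩ := h k l hne
  have := exponent_mem_nonnegPart.1 (hkl (exponent_mem_nonnegPart.2 hw))
  exact (weight_frontier_neg l t ht).not_ge this

theorem eq_of_nonnegPart_subset_permute {k l : Fin 23} {σ : Equiv.Perm (Fin 7)}
    (h : nonnegPart (rVec k) ⊆ permute σ (nonnegPart (rVec l))) : k = l :=
  eq_of_nonnegPart_subset
    (nonnegPart_subset_of_subset_permute (antitone_rVec k) (antitone_rVec l) h)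

/-- For each of the first 22 vectors, seven monomials of weight zero, counted with multiplicity,
whose product is `(x₀ ⋯ x₆)³`. -/
def balanced : Fin 22 → Combination :=
  ![[(2, 0, 4, 6), (1, 0, 5, 5), (1, 1, 1, 6), (1, 1, 3, 4), (1, 2, 2, 5), (1, 2, 3, 3)],
    [(2, 0, 3, 6), (1, 0, 5, 5), (1, 1, 2, 6), (1, 1, 3, 5), (1, 1, 4, 4), (1, 2, 2, 4)],
    [(2, 0, 3, 6), (1, 0, 5, 5), (1, 1, 2, 6), (1, 1, 3, 4), (1, 1, 4, 4), (1, 2, 2, 5)],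
    [(1, 0, 3, 3), (1, 0, 3, 4), (1, 0, 4, 4), (1, 1, 5, 5), (1, 1, 5, 6), (1, 1, 6, 6),
      (1, 2, 2, 2)],
    [(2, 0, 3, 6), (1, 0, 4, 5), (1, 1, 2, 6), (1, 1, 3, 5), (1, 1, 4, 4), (1, 2, 2, 5)],
    [(2, 0, 3, 6), (1, 0, 5, 5), (1, 1, 1, 6), (1, 1, 4, 4), (1, 2, 2, 5), (1, 2, 3, 4)],
    [(2, 0, 3, 6), (1, 0, 4, 5), (1, 1, 1, 6), (1, 1, 3, 5), (1, 2, 2, 5), (1, 2, 4, 4)],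
    [(2, 0, 2, 6), (1, 0, 5, 5), (1, 1, 1, 6), (1, 1, 4, 4), (1, 2, 3, 5), (1, 3, 3, 4)],
    [(1, 0, 4, 4), (1, 0, 4, 5), (1, 0, 5, 5), (1, 1, 1, 6), (1, 1, 2, 6), (1, 2, 2, 6),
      (1, 3, 3, 3)],
    [(3, 0, 2, 6), (1, 1, 4, 4), (1, 1, 4, 5), (1, 1, 5, 5), (1, 3, 3, 3)],
    [(1, 0, 4, 4), (1, 0, 4, 5), (1, 0, 5, 5), (3, 1, 2, 6), (1, 3, 3, 3)],
    [(2, 0, 2, 6), (1, 0, 4, 5), (1, 1, 1, 6), (1, 1, 4, 4), (1, 2, 3, 5), (1, 3, 3, 5)],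
    [(1, 0, 3, 6), (1, 0, 4, 4), (1, 0, 4, 5), (1, 1, 1, 6), (1, 1, 2, 6), (2, 2, 3, 5)],
    [(1, 0, 0, 6), (1, 0, 1, 6), (1, 1, 1, 6), (1, 2, 4, 4), (1, 2, 4, 5), (1, 2, 5, 5),
      (1, 3, 3, 3)],
    [(1, 0, 5, 5), (1, 0, 5, 6), (1, 0, 6, 6), (1, 1, 1, 1), (1, 2, 2, 2), (1, 3, 3, 3),
      (1, 4, 4, 4)],
    [(3, 0, 3, 5), (1, 1, 1, 6), (1, 1, 2, 6), (1, 2, 2, 6), (1, 4, 4, 4)],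
    [(3, 0, 2, 6), (3, 1, 3, 5), (1, 4, 4, 4)],
    [(1, 0, 0, 6), (1, 0, 1, 6), (1, 1, 1, 6), (3, 2, 3, 5), (1, 4, 4, 4)],
    [(3, 0, 2, 5), (3, 1, 3, 6), (1, 4, 4, 4)],
    [(1, 0, 0, 5), (1, 0, 1, 5), (1, 1, 1, 5), (1, 2, 2, 6), (1, 2, 3, 6), (1, 3, 3, 6),
      (1, 4, 4, 4)],
    [(1, 0, 0, 6), (1, 0, 1, 6), (1, 1, 1, 6), (1, 2, 2, 2), (1, 3, 3, 3), (1, 4, 4, 4),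
      (1, 5, 5, 5)],
    [(3, 0, 1, 6), (1, 2, 2, 2), (1, 3, 3, 3), (1, 4, 4, 4), (1, 5, 5, 5)]]

theorem not_unstable_castSucc (k : Fin 22) : ¬ Unstable (nonnegPart (rVec k.castSucc)) := by
  have h : ∀ k, balanced k ≠ [] ∧ (∀ i, (balanced k).total i = 3) ∧
      ∀ p ∈ balanced k, 0 < p.1 ∧ 0 ≤ p.2.weight (rVec k.castSucc) := by decide +kernel
  obtain ⟨hne, htot, hp⟩ := h k
  rintro ⟨r, hr, hsub⟩
  have hpos : 0 < r ⬝ᵥ (balanced k).total :=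
    Combination.dotProduct_total_pos hne (fun p hpk => (hp p hpk).1) fun p hpk => by
      rw [← Triple.dotProduct_exponent]
      exact (hsub (exponent_mem_nonnegPart.2 (hp p hpk).2)).2
  have hsum : ∑ i, r i = 0 := hr.1
  rw [funext htot, dotProduct, ← Finset.sum_mul, hsum, zero_mul] at hpos
  exact lt_irrefl _ hpos

theorem unstable_lastIndex : Unstable (nonnegPart (rVec lastIndex)) := by
  -- A small perturbation of the direction of `rVec lastIndex`.
  let r : Fin 7 → ℤ := ![19, 12, 5, 5, -9, -9, -23]
  have h : ∀ t : Triple, 0 ≤ t.weight (rVec lastIndex) → 0 < t.weight r := by decide +kernel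
  refine ⟨r, ⟨show ∑ k, r k = 0 by decide, fun h0 => absurd (congrFun h0 0) (by decide)⟩, ?_⟩
  rintro x ⟨hx, hxr⟩
  obtain ⟨t, -, rfl⟩ := exists_sorted_of_mem_simplex hx
  rw [Triple.dotProduct_exponent] at hxr
  exact ⟨hx, by rw [Triple.dotProduct_exponent]; exact h t hxr⟩

theorem unstable_nonnegPart_rVec_iff (k : Fin 23) :
    Unstable (nonnegPart (rVec k)) ↔ k = lastIndex := by
  refine ⟨fun h => ?_, fun h => h ▸ unstable_lastIndex⟩
  induction k using Fin.lastCases with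
  | last => rfl
  | cast k => exact absurd h (not_unstable_castSucc k)

/-! ### Maximal half-simplices and maximal strictly semi-stable sets -/

theorem nonnegPart_mem_halfSimplices {r : Fin 7 → ℤ} (hr : IsOnePS r) :
    nonnegPart r ∈ halfSimplices :=
  ⟨r, hr, rfl⟩

theorem permute_rVec_mem_halfSimplices (k : Fin 23) (σ : Equiv.Perm (Fin 7)) :
    permute σ (nonnegPart (rVec k)) ∈ halfSimplices := by
  rw [permute_nonnegPart]
  exact nonnegPart_mem_halfSimplices ((isOnePS_rVec k).comp_perm σ)

theorem NotStable.exists_subset_permute {A : Set (Fin 7 → ℤ)} (hA : NotStable A) :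
    ∃ k σ, A ⊆ permute σ (nonnegPart (rVec k)) := by
  obtain ⟨r, hr, hAr⟩ := hA
  obtain ⟨k, σ, h⟩ := exists_nonnegPart_subset_permute hr
  exact ⟨k, σ, hAr.trans h⟩

theorem NotStable.subset_simplex {A : Set (Fin 7 → ℤ)} (hA : NotStable A) : A ⊆ simplex :=
  let ⟨_, _, h⟩ := hA
  h.trans fun _ hx => hx.1

theorem notStable_of_mem_halfSimplices {A : Set (Fin 7 → ℤ)} (hA : A ∈ halfSimplices) :
    NotStable A :=
  let ⟨r, hr, h⟩ := hA
  ⟨r, hr, h.le⟩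

/-- The sets `permute σ (nonnegPart (rVec k))` form an antichain, since an inclusion forces the
indices to agree, and then both sets have the same cardinality. -/
theorem permute_rVec_antichain {k l : Fin 23} {σ τ : Equiv.Perm (Fin 7)}
    (h : permute σ (nonnegPart (rVec k)) ⊆ permute τ (nonnegPart (rVec l))) :
    permute σ (nonnegPart (rVec k)) = permute τ (nonnegPart (rVec l)) := by
  obtain rfl : k = l := by
    have h' := subset_permute_iff.1 h
    rw [permute_permute, ← inv_inv (σ * τ⁻¹), ← subset_permute_iff] at h'
    exact eq_of_nonnegPart_subset_permute h'
  have hinj (ρ : Equiv.Perm (Fin 7)) : Function.Injective fun x : Fin 7 → ℤ => x ∘ ρ :=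
    ρ.surjective.injective_comp_right
  refine Set.eq_of_subset_of_ncard_le h ?_ ?_
  · rw [permute, permute, Set.ncard_image_of_injective _ (hinj τ),
      Set.ncard_image_of_injective _ (hinj σ)]
  · exact (finite_simplex.subset fun _ hx => hx.1).image _

/-- A set that is not stable and contains one of the maximal sets is equal to it. -/
theorem NotStable.subset_permute_rVec {A : Set (Fin 7 → ℤ)} (hA : NotStable A) {k : Fin 23}
    {σ : Equiv.Perm (Fin 7)} (h : permute σ (nonnegPart (rVec k)) ⊆ A) :
    A ⊆ permute σ (nonnegPart (rVec k)) := by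
  obtain ⟨l, τ, hl⟩ := hA.exists_subset_permute
  rwa [permute_rVec_antichain (h.trans hl)]

theorem maximal_halfSimplices_iff (A : Set (Fin 7 → ℤ)) :
    Maximal (· ∈ halfSimplices) A ↔
      ∃ (k : Fin 23) (σ : Equiv.Perm (Fin 7)), A = permute σ (nonnegPart (rVec k)) := by
  constructor
  · intro hA
    obtain ⟨k, σ, h⟩ := (notStable_of_mem_halfSimplices hA.prop).exists_subset_permute
    exact ⟨k, σ, hA.eq_of_le (permute_rVec_mem_halfSimplices k σ) h⟩
  · rintro ⟨k, σ, rfl⟩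
    exact ⟨permute_rVec_mem_halfSimplices k σ,
      fun B hB h => (notStable_of_mem_halfSimplices hB).subset_permute_rVec h⟩

theorem strictlySemistable_permute_rVec {k : Fin 23} (hk : k ≠ lastIndex)
    (σ : Equiv.Perm (Fin 7)) : StrictlySemistable (permute σ (nonnegPart (rVec k))) := by
  refine ⟨notStable_of_mem_halfSimplices (permute_rVec_mem_halfSimplices k σ), ?_⟩
  rwa [unstable_permute_iff, unstable_nonnegPart_rVec_iff]

theorem StrictlySemistable.exists_subset_permute {A : Set (Fin 7 → ℤ)}
    (hA : StrictlySemistable A) :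
    ∃ (k : Fin 23) (σ : Equiv.Perm (Fin 7)),
      k ≠ lastIndex ∧ A ⊆ permute σ (nonnegPart (rVec k)) := by
  obtain ⟨k, σ, h⟩ := hA.1.exists_subset_permute
  refine ⟨k, σ, ?_, h⟩
  rintro rfl
  exact hA.2 ((unstable_lastIndex.permute σ).mono h)

theorem maximal_strictlySemistable_iff (A : Set (Fin 7 → ℤ)) :
    Maximal StrictlySemistable A ↔
      ∃ (k : Fin 23) (σ : Equiv.Perm (Fin 7)),
        k ≠ lastIndex ∧ A = permute σ (nonnegPart (rVec k)) := by
  constructor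
  · intro hA
    obtain ⟨k, σ, hk, h⟩ := hA.prop.exists_subset_permute
    exact ⟨k, σ, hk, hA.eq_of_le (strictlySemistable_permute_rVec hk σ) h⟩
  · rintro ⟨k, σ, hk, rfl⟩
    exact ⟨strictlySemistable_permute_rVec hk σ, fun B hB h => hB.1.subset_permute_rVec h⟩

/-! ### Families of cubic forms -/

theorem mem_supp {f : MvPolynomial (Fin 7) ℂ} {x : Fin 7 → ℤ} :
    x ∈ supp f ↔ ∃ m ∈ f.support, x = fun k => (m k : ℤ) := by
  simp only [supp, Set.mem_ofPred_eq, funext_iff]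

/-- Every set of exponents of cubic monomials is the support of a cubic form, namely of the sum of
its monomials. -/
theorem exists_supp_eq {A : Set (Fin 7 → ℤ)} (hA : A ⊆ simplex) :
    ∃ f : MvPolynomial (Fin 7) ℂ, f.IsHomogeneous 3 ∧ supp f = A := by
  let e : (Fin 7 →₀ ℕ) → Fin 7 → ℤ := fun m k => (m k : ℤ)
  have he : Function.Injective e := fun m n h => by
    ext k
    exact Int.natCast_inj.1 (congrFun h k)
  have hfin : (e ⁻¹' A).Finite := (finite_simplex.subset hA).preimage he.injOn
  let f : MvPolynomial (Fin 7) ℂ := ∑ m ∈ hfin.toFinset, MvPolynomial.monomial m 1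
  have hcoeff : ∀ m, m ∈ f.support ↔ e m ∈ A := by
    classical
    intro m
    rw [MvPolynomial.mem_support_iff, MvPolynomial.coeff_sum]
    simp [MvPolynomial.coeff_monomial]
  refine ⟨f, MvPolynomial.IsHomogeneous.sum _ _ _ fun m hm => ?_, ?_⟩
  · refine MvPolynomial.isHomogeneous_monomial _ ?_
    have hs : ∑ k, (m k : ℤ) = 3 := (hA (hfin.mem_toFinset.1 hm)).1
    rw [Finsupp.degree_eq_sum]
    exact_mod_cast hs
  · ext x
    rw [mem_supp]
    constructor
    · rintro ⟨m, hm, rfl⟩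
      exact (hcoeff m).1 hm
    · intro hx
      have hex : e (Finsupp.equivFunOnFinite.symm fun k => (x k).toNat) = x := by
        funext k
        simpa [e] using (hA hx).2 k
      exact ⟨_, (hcoeff _).2 (hex.symm ▸ hx), hex.symm⟩

theorem cubicFamily_subset_iff {A B : Set (Fin 7 → ℤ)} (hA : A ⊆ simplex) :
    cubicFamily A ⊆ cubicFamily B ↔ A ⊆ B := by
  refine ⟨fun h => ?_, fun h f hf => ⟨hf.1, hf.2.trans h⟩⟩
  obtain ⟨f, hf, rfl⟩ := exists_supp_eq hA
  exact (h ⟨hf, subset_rfl⟩).2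

theorem StrictlySemistable.nonempty {A : Set (Fin 7 → ℤ)} (hA : StrictlySemistable A) :
    A.Nonempty := by
  rw [Set.nonempty_iff_ne_empty]
  rintro rfl
  exact hA.2 ⟨rVec 0, isOnePS_rVec 0, Set.empty_subset _⟩

theorem strictlySemistableFamily_iff {V : Set (MvPolynomial (Fin 7) ℂ)} :
    StrictlySemistableFamily V ↔ ∃ A, StrictlySemistable A ∧ V = cubicFamily A := by
  constructor
  · rintro ⟨f, hf, rfl⟩
    exact ⟨supp f, hf.2.2, rfl⟩
  · rintro ⟨A, hA, rfl⟩
    obtain ⟨f, hf, rfl⟩ := exists_supp_eq hA.1.subset_simplex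
    refine ⟨f, ⟨hf, ?_, hA⟩, rfl⟩
    rintro rfl
    obtain ⟨x, hx⟩ := hA.nonempty
    obtain ⟨m, hm, -⟩ := mem_supp.1 hx
    simp at hm

theorem maximal_strictlySemistableFamily_iff (V : Set (MvPolynomial (Fin 7) ℂ)) :
    Maximal StrictlySemistableFamily V ↔
      ∃ A, Maximal StrictlySemistable A ∧ V = cubicFamily A := by
  constructor
  · intro hV
    obtain ⟨A, hA, rfl⟩ := strictlySemistableFamily_iff.1 hV.prop
    refine ⟨A, ⟨hA, fun B hB hAB => ?_⟩, rfl⟩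
    exact (cubicFamily_subset_iff hB.1.subset_simplex).1
      (hV.2 (strictlySemistableFamily_iff.2 ⟨B, hB, rfl⟩)
        ((cubicFamily_subset_iff hA.1.subset_simplex).2 hAB))
  · rintro ⟨A, hA, rfl⟩
    refine ⟨strictlySemistableFamily_iff.2 ⟨A, hA.prop, rfl⟩, fun W hW hAW => ?_⟩
    obtain ⟨B, hB, rfl⟩ := strictlySemistableFamily_iff.1 hW
    exact (cubicFamily_subset_iff hB.1.subset_simplex).2
      (hA.2 hB ((cubicFamily_subset_iff hA.prop.1.subset_simplex).1 hAW))

end CubicFivefold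

theorem mainTheorem5 :
    -- each listed vector is a reduced one-parameter subgroup with nonincreasing entries
    (∀ k, IsOnePS (rVec k) ∧ Antitone (rVec k) ∧ IsReducedVector (rVec k)) ∧
    -- up to permutation of the coordinates, the maximal elements are exactly the 23 sets
    (∀ A : Set (Fin 7 → ℤ), Maximal (· ∈ halfSimplices) A ↔
      ∃ (k : Fin 23) (σ : Equiv.Perm (Fin 7)), A = permute σ (nonnegPart (rVec k))) ∧
    -- the 23 sets are pairwise inequivalent under permutations
    (∀ (k l : Fin 23) (σ : Equiv.Perm (Fin 7)),
      nonnegPart (rVec k) = permute σ (nonnegPart (rVec l)) → k = l) ∧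
    -- only the last one is unstable
    (∀ k : Fin 23, Unstable (nonnegPart (rVec k)) ↔ k = lastIndex) ∧
    -- the maximal strictly semi-stable subsets of the simplex
    (∀ A : Set (Fin 7 → ℤ), Maximal StrictlySemistable A ↔
      ∃ (k : Fin 23) (σ : Equiv.Perm (Fin 7)),
        k ≠ lastIndex ∧ A = permute σ (nonnegPart (rVec k))) ∧
    -- the maximal strictly semi-stable families of cubic forms
    (∀ V : Set (MvPolynomial (Fin 7) ℂ), Maximal StrictlySemistableFamily V ↔
      ∃ (k : Fin 23) (σ : Equiv.Perm (Fin 7)),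
        k ≠ lastIndex ∧ V = cubicFamily (permute σ (nonnegPart (rVec k)))) ∧
    -- every strictly semi-stable cubic form belongs to one of these families
    (∀ f : MvPolynomial (Fin 7) ℂ, StrictlySemistableCubic f →
      ∃ (k : Fin 23) (σ : Equiv.Perm (Fin 7)),
        k ≠ lastIndex ∧ f ∈ cubicFamily (permute σ (nonnegPart (rVec k)))) := by
  refine ⟨fun k => ⟨isOnePS_rVec k, antitone_rVec k, isReducedVector_rVec k⟩,
    maximal_halfSimplices_iff, fun k l σ h => eq_of_nonnegPart_subset_permute h.le,
    unstable_nonnegPart_rVec_iff, maximal_strictlySemistable_iff, fun V => ?_, fun f hf => ?_⟩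
  · rw [maximal_strictlySemistableFamily_iff]
    simp only [maximal_strictlySemistable_iff]
    constructor
    · rintro ⟨_, ⟨k, σ, hk, rfl⟩, rfl⟩
      exact ⟨k, σ, hk, rfl⟩
    · rintro ⟨k, σ, hk, rfl⟩
      exact ⟨_, ⟨k, σ, hk, rfl⟩, rfl⟩
  · obtain ⟨k, σ, hk, h⟩ := hf.2.2.exists_subset_permute
    exact ⟨k, σ, hk, hf.1, h⟩
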